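/- Let $I, J \ge 1$ be integers and let $b_1(x,y), b_2(x,y) \in [0,1]$, $x, y \in \mathbb{Z}_{\ge 1}$, be parameters with $b_k(x+I,y) = b_k(x,y)$ and $b_k(x,y+J) = b_k(x,y)$ for all $x, y \ge 1$ and $k \in \{1,2\}$. Consider the inhomogeneous stochastic six vertex model on $\mathbb{Z}_{\ge 1}^2$ with these parameters and step initial data: a line enters every vertex $(1,y)$ from the left, no line enters any vertex $(x,1)$ from the bottom, and the vertices are sampled one after the other in the order $(1,1),(2,1),(1,2),(3,1),(2,2),(1,3),\dots$. Given the input lines on its left and bottom edges, which are the output lines of its left and lower neighbours, the vertex $(x,y)$ receives its output lines as follows, independently of everything else sampled before: two input lines yield two output lines (top and right); no input line yields no output line; a single line from the bottom leaves through the top with probability $b_1(x,y)$ and to the right with probability $1-b_1(x,y)$; a single line from the left leaves to the right with probability $b_2(x,y)$ and through the top with probability $1-b_2(x,y)$. For integers $x, y \ge 0$ let the height function $h(x,y)$ be the number of lines passing to the right of the point $(x+\tfrac12, y+\tfrac12)$, that is, the number of $k \in \{1,\dots,y\}$ such that there is a line on the edge from $(x,k)$ to $(x+1,k)$. Then there is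 a deterministic Lipschitz function $g : \mathbb{R}_{\ge 0}^2 \to \mathbb{R}$, depending only on $b_1$ and $b_2$, such that, with probability $1$, $$\lim_{n\to\infty} \frac{h(\lfloor nx\rfloor, \lfloor ny\rfloor)}{n} = g(x,y) \qquad \text{for all } x, y \in \mathbb{R}_{\ge 0} \text{ simultaneously.}$$ -/

import Mathlib

open MeasureTheory Filter Topology

/-- The six vertex configurations of the stochastic six vertex (S6V) model. -/
inductive S6VConfig where
  /-- type I: a line on each of the four edges -/
  | full
  /-- type II: no line -/
  | empty
  /-- type III: a line from the bottom to the top -/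
  | vertical
  /-- type IV: a line from the bottom to the right -/
  | bottomToRight
  /-- type V: a line from the left to the right -/
  | horizontal
  /-- type VI: a line from the left to the top -/
  | leftToTop
  deriving DecidableEq

namespace S6VConfig

instance : MeasurableSpace S6VConfig := ⊤

/-- Is there a line on the bottom edge (vertical input)? -/
def bottom : S6VConfig → Bool
  | full => true
  | empty => false
  | vertical => true
  | bottomToRight => true
  | horizontal => false
  | leftToTop => false

/-- Is there a line on the left edge (horizontal input)? -/
def left : S6VConfig → Bool
  | full => true
  | empty => false
  | vertical => false
  | bottomToRight => false
  | horizontal => true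
  | leftToTop => true

/-- Is there a line on the top edge (vertical output)? -/
def top : S6VConfig → Bool
  | full => true
  | empty => false
  | vertical => true
  | bottomToRight => false
  | horizontal => false
  | leftToTop => true

/-- Is there a line on the right edge (horizontal output)? -/
def right : S6VConfig → Bool
  | full => true
  | empty => false
  | vertical => false
  | bottomToRight => true
  | horizontal => true
  | leftToTop => false

/-- The weight of a configuration at a vertex with parameters `b₁`, `b₂`. -/
def weight (b₁ b₂ : ℝ) : S6VConfig → ℝ
  | full => 1
  | empty => 1
  | vertical => b₁
  | bottomToRight => 1 - b₁
  | horizontal => b₂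
  | leftToTop => 1 - b₂

/-- The probability of choosing the configuration `t` at a vertex with parameters `b₁`, `b₂`
whose inputs are `i` (from the bottom) and `j` (from the left): only the configurations
with these inputs are allowed, and each allowed one is chosen with its weight. -/
def prob (b₁ b₂ : ℝ) (i j : Bool) (t : S6VConfig) : ℝ :=
  if t.bottom = i ∧ t.left = j then t.weight b₁ b₂ else 0

end S6VConfig

namespace S6V

/-- The vertex `(x', y')` of `ℤ_{≥1}²` comes strictly before the vertex `(x, y)` in the order
`(1,1), (2,1), (1,2), (3,1), (2,2), (1,3), …`. -/
def Before (x' y' x y : ℕ) : Prop :=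
  1 ≤ x' ∧ 1 ≤ y' ∧ (x' + y' < x + y ∨ (x' + y' = x + y ∧ y' < y))

/-- The line on the horizontal edge from `(x - 1, y)` to `(x, y)`, i.e. the input from the left of
the vertex `(x, y)` (`x, y ≥ 1`) in the tiling `c` of the quadrant. Step initial data: a line enters
every vertex `(1, y)` from the left. -/
def leftInput (c : ℕ → ℕ → S6VConfig) (x y : ℕ) : Bool :=
  if x = 1 then true else (c (x - 1) y).right

/-- The line on the vertical edge from `(x, y - 1)` to `(x, y)`, i.e. the input from the bottom of
the vertex `(x, y)` (`x, y ≥ 1`) in the tiling `c` of the quadrant. Step initial data: no line enters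
a vertex `(x, 1)` from the bottom. -/
def bottomInput (c : ℕ → ℕ → S6VConfig) (x y : ℕ) : Bool :=
  if y = 1 then false else (c x (y - 1)).top

/-- `σ` is a realization, on the probability space `(Ω, μ)`, of the S6V model with parameters
`b₁ (x, y)`, `b₂ (x, y)` and step initial data: `σ x y` is the random configuration of the vertex
`(x, y)`, `x, y ≥ 1` (values at other indices are irrelevant), and the vertices are sampled one
after the other in the order of `Before`. That is, given that the vertices before `(x, y)` have
the configurations prescribed by `c`, the vertex `(x, y)` gets the configuration `t` with
probability `S6VConfig.prob` for the inputs it receives in `c`. -/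
structure IsModel {Ω : Type*} [MeasurableSpace Ω] (b₁ b₂ : ℕ → ℕ → ℝ) (μ : Measure Ω)
    (σ : ℕ → ℕ → Ω → S6VConfig) : Prop where
  measurable : ∀ x y : ℕ, 1 ≤ x → 1 ≤ y → Measurable (σ x y)
  sampling : ∀ x y : ℕ, 1 ≤ x → 1 ≤ y → ∀ (c : ℕ → ℕ → S6VConfig) (t : S6VConfig),
    μ {ω | (∀ x' y', Before x' y' x y → σ x' y' ω = c x' y') ∧ σ x y ω = t} =
      μ {ω | ∀ x' y', Before x' y' x y → σ x' y' ω = c x' y'} *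
        ENNReal.ofReal
          (S6VConfig.prob (b₁ x y) (b₂ x y) (bottomInput c x y) (leftInput c x y) t)

/-- The height function `h (x, y)`, `x, y ≥ 0`, of a tiling: the number of lines passing to the
right of the point `(x, y)` (drawn slightly northeast of the vertex), i.e. the number of horizontal
edges from `(x, k)` to `(x + 1, k)`, `1 ≤ k ≤ y`, that carry a line. -/
def height (c : ℕ → ℕ → S6VConfig) (x y : ℕ) : ℕ :=
  ((Finset.Icc 1 y).filter fun k => leftInput c (x + 1) k = true).card

end S6V

/-! Give every vertex two independent coins that fix in advance what a lone line from the bottom, or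
from the left, would do. Flows with different boundary data can then share the coins, and the
dynamics is monotone and conserves lines. Restart the flow at (a,b) from step data: filling the left
side only adds flux, and dropping the lines that enter from below costs at most their number, which
is exactly the drop of the height H at level b between columns a and a+x. Hence H(a+x,b+y) ≤ H(a,b)
+ H'(x,y), with H' read off the shifted coins (`stepHeight_add_le`).

For (a,b) in the period lattice, H' has the law of H and is independent of H(a,b). Taking means,
Fekete's lemma gives the limit g (`exists_tendsto_floor_of_subadditive`). Taking squares at (x,y) =
(a,b), E H(2a,2b)² ≤ 4 E H(a,b)² - 2 Var H(a,b), so the normalized variances are summable along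
dyadic multiples (`summable_variance`); Chebyshev and Borel–Cantelli give almost sure convergence
there. Since the height and its mean are Lipschitz, these countably many sequences control all rays
at once (`tendsto_floor_of_tendsto_dyadic`).

An arbitrary realization is known only through its sampling probabilities; `IsModel.measure_eq`
transfers events on finitely many vertices to it from the coin model. -/

/-- The configuration at a vertex with inputs `i` (bottom) and `j` (left), where the first
component of `u` decides whether a single line from the bottom goes up, and the second one whether
a single line from the left goes to the right. -/
def S6VConfig.ofInputs (u : Bool × Bool) : Bool → Bool → S6VConfig
  | true, true => .full
  | false, false => .empty
  | true, false => if u.1 then .vertical else .bottomToRight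
  | false, true => if u.2 then .horizontal else .leftToTop

/-! ### Pathwise theory: monotonicity, conservation of lines and subadditivity. -/

namespace S6V

/-- The lines on the top and the right edge of the vertices of the quadrant, for the local
decisions `e` and the boundary data `L` (left) and `B` (bottom). The vertex `(x + 1, y + 1)` uses
the decision `e (x, y)`; the boundary edges are recorded at `x = 0` and at `y = 0`. -/
def flow (e : ℕ × ℕ → Bool × Bool) (L B : ℕ → Bool) : ℕ → ℕ → Bool × Bool
  | 0, 0 => (false, false)
  | 0, y + 1 => (false, L y)
  | x + 1, 0 => (B x, false)
  | x + 1, y + 1 =>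
    ((S6VConfig.ofInputs (e (x, y)) (flow e L B (x + 1) y).1 (flow e L B x (y + 1)).2).top,
      (S6VConfig.ofInputs (e (x, y)) (flow e L B (x + 1) y).1 (flow e L B x (y + 1)).2).right)
termination_by x y => x + y

/-- The number of horizontal lines between columns `x` and `x + 1` in the first `y` rows. -/
def flux (e : ℕ × ℕ → Bool × Bool) (L B : ℕ → Bool) (x y : ℕ) : ℕ :=
  ∑ k ∈ Finset.range y, (flow e L B x (k + 1)).2.toNat

/-- The height function of the flow with step initial data. -/
def stepHeight (e : ℕ × ℕ → Bool × Bool) (x y : ℕ) : ℕ :=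
  flux e (fun _ => true) (fun _ => false) x y

lemma S6VConfig.top_add_right_ofInputs (u : Bool × Bool) (i j : Bool) :
    (S6VConfig.ofInputs u i j).top.toNat + (S6VConfig.ofInputs u i j).right.toNat
      = i.toNat + j.toNat := by
  obtain ⟨a, b⟩ := u
  revert a b i j
  decide

/-- Single inputs from different sides are incomparable, and no input or two inputs force the
outputs. Hence shared coins preserve the order whatever the parameters are. -/
lemma S6VConfig.ofInputs_mono (u : Bool × Bool) {i j i' j' : Bool} (hi : i ≤ i') (hj : j ≤ j') :
    (S6VConfig.ofInputs u i j).top ≤ (S6VConfig.ofInputs u i' j').top ∧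
      (S6VConfig.ofInputs u i j).right ≤ (S6VConfig.ofInputs u i' j').right := by
  obtain ⟨a, b⟩ := u
  revert a b i j i' j'
  decide

variable {e : ℕ × ℕ → Bool × Bool} {L B L' B' : ℕ → Bool}

lemma flow_mono (hL : L ≤ L') (hB : B ≤ B') : ∀ x y : ℕ, flow e L B x y ≤ flow e L' B' x y
  | 0, 0 => by simp [flow]
  | 0, y + 1 => by rw [flow, flow]; exact ⟨le_rfl, hL y⟩
  | x + 1, 0 => by rw [flow, flow]; exact ⟨hB x, le_rfl⟩
  | x + 1, y + 1 => by
    rw [flow, flow]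
    exact S6VConfig.ofInputs_mono _ (flow_mono hL hB (x + 1) y).1 (flow_mono hL hB x (y + 1)).2
termination_by x y => x + y

lemma flux_succ (x y : ℕ) :
    flux e L B x (y + 1) = flux e L B x y + (flow e L B x (y + 1)).2.toNat :=
  Finset.sum_range_succ _ _

lemma flux_succ_left_add (x y : ℕ) :
    flux e L B (x + 1) y + (flow e L B (x + 1) y).1.toNat = flux e L B x y + (B x).toNat := by
  induction y with
  | zero => simp [flux, flow]
  | succ y ih =>
    have h := S6VConfig.top_add_right_ofInputs (e (x, y)) (flow e L B (x + 1) y).1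
      (flow e L B x (y + 1)).2
    rw [flux_succ, flux_succ, flow]
    dsimp only
    omega

/-- Conservation of lines in the rectangle of columns a+1, …, a+x and rows 1, …, y. -/
lemma flux_add_sum_top (x y : ℕ) (a : ℕ) :
    flux e L B (a + x) y + ∑ i ∈ Finset.range x, (flow e L B (a + i + 1) y).1.toNat
      = flux e L B a y + ∑ i ∈ Finset.range x, (B (a + i)).toNat := by
  induction x with
  | zero => simp
  | succ x ih =>
    have h := flux_succ_left_add (e := e) (L := L) (B := B) (a + x) y
    rw [Finset.sum_range_succ, Finset.sum_range_succ, ← add_assoc a x 1]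
    omega

/-- Markov property: northeast of (a,b) the flow is driven by the shifted coins and the lines
crossing the new axes. The two edge types have separate index ranges because `flow` puts a dummy
`false` in the other component on the axes. -/
lemma flow_shift (a b : ℕ) : ∀ x y : ℕ,
    (flow e L B (a + x + 1) (b + y)).1 =
        (flow (fun v => e (a + v.1, b + v.2)) (fun k => (flow e L B a (b + k + 1)).2)
          (fun i => (flow e L B (a + i + 1) b).1) (x + 1) y).1 ∧
      (flow e L B (a + x) (b + y + 1)).2 =
        (flow (fun v => e (a + v.1, b + v.2)) (fun k => (flow e L B a (b + k + 1)).2)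
          (fun i => (flow e L B (a + i + 1) b).1) x (y + 1)).2
  | 0, 0 => by simp [flow]
  | 0, y + 1 => by
    have h := flow_shift a b 0 y
    refine ⟨?_, by simp [flow, add_assoc]⟩
    rw [flow, ← add_assoc b y 1, flow, ← h.1]
    simp only [flow, add_zero]
  | x + 1, 0 => by
    have h := flow_shift a b x 0
    refine ⟨by simp [flow, add_assoc], ?_⟩
    rw [flow, ← add_assoc a x 1, flow, ← h.2]
    simp only [flow, add_zero]
  | x + 1, y + 1 => by
    have h := flow_shift a b (x + 1) y
    have h' := flow_shift a b x (y + 1)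
    constructor
    · rw [flow, ← add_assoc b y 1, flow]
      simp only
      rw [← h.1, ← h.2]
    · rw [flow, ← add_assoc a x 1, flow]
      simp only
      rw [← h'.1, ← h'.2]
termination_by x y => x + y

lemma flux_mono (hL : L ≤ L') (hB : B ≤ B') (x y : ℕ) : flux e L B x y ≤ flux e L' B' x y :=
  Finset.sum_le_sum fun k _ => Bool.toNat_le_toNat (flow_mono hL hB x (k + 1)).2

/-- Compare the two conservation laws: the left inputs agree, and by monotonicity the larger flow
also loses at least as many lines through the top. -/
lemma flux_le_flux_add_sum (hB : B ≤ B') (x y : ℕ) :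
    flux e L B' x y ≤ flux e L B x y + ∑ i ∈ Finset.range x, (B' i).toNat := by
  have h := flux_add_sum_top (e := e) (L := L) (B := B) x y 0
  have h' := flux_add_sum_top (e := e) (L := L) (B := B') x y 0
  have hT : ∑ i ∈ Finset.range x, (flow e L B (0 + i + 1) y).1.toNat ≤
      ∑ i ∈ Finset.range x, (flow e L B' (0 + i + 1) y).1.toNat :=
    Finset.sum_le_sum fun i _ => Bool.toNat_le_toNat (flow_mono le_rfl hB (0 + i + 1) y).1
  have h0 : flux e L B 0 y = flux e L B' 0 y := by simp [flux, flow]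
  simp only [zero_add] at h h' hT
  omega

/-- Subadditivity of the height function under restarting from step initial data. -/
lemma stepHeight_add_le (e : ℕ × ℕ → Bool × Bool) (a b x y : ℕ) :
    stepHeight e (a + x) (b + y) ≤
      stepHeight e a b + stepHeight (fun v => e (a + v.1, b + v.2)) x y := by
  unfold stepHeight
  set L : ℕ → Bool := fun _ => true
  set B : ℕ → Bool := fun _ => false
  set B' : ℕ → Bool := fun i => (flow e L B (a + i + 1) b).1
  have h1 : flux e L B (a + x) (b + y) = flux e L B (a + x) b +
      flux (fun v => e (a + v.1, b + v.2)) (fun k => (flow e L B a (b + k + 1)).2) B' x y := by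
    unfold flux
    rw [Finset.sum_range_add]
    congr 1
    exact Finset.sum_congr rfl fun k _ => by rw [(flow_shift a b x k).2]
  have h2 : flux (fun v => e (a + v.1, b + v.2)) (fun k => (flow e L B a (b + k + 1)).2) B' x y ≤
      flux (fun v => e (a + v.1, b + v.2)) L B' x y :=
    flux_mono (fun k => Bool.le_true _) le_rfl x y
  have h3 := flux_le_flux_add_sum (e := fun v => e (a + v.1, b + v.2)) (L := L) (B := B) (B' := B')
    (fun k => Bool.false_le _) x y
  -- The lines entering the upper block from below are those that left the lower one through its
  -- top, so their number cancels the cost in `h3`.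
  have h4 := flux_add_sum_top (e := e) (L := L) (B := B) x b a
  have h5 : ∑ i ∈ Finset.range x, (B (a + i)).toNat = 0 := by simp [B]
  have h6 : ∑ i ∈ Finset.range x, (B' i).toNat =
    ∑ i ∈ Finset.range x, (flow e L B (a + i + 1) b).1.toNat := rfl
  omega

lemma stepHeight_succ_right (e : ℕ × ℕ → Bool × Bool) (x y : ℕ) :
    stepHeight e x y ≤ stepHeight e x (y + 1) ∧
      stepHeight e x (y + 1) ≤ stepHeight e x y + 1 := by
  unfold stepHeight
  rw [flux_succ]
  have := Bool.toNat_le (flow e (fun _ => true) (fun _ => false) x (y + 1)).2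
  omega

lemma stepHeight_succ_left (e : ℕ × ℕ → Bool × Bool) (x y : ℕ) :
    stepHeight e (x + 1) y ≤ stepHeight e x y ∧
      stepHeight e x y ≤ stepHeight e (x + 1) y + 1 := by
  have h := flux_succ_left_add (e := e) (L := fun _ => true) (B := fun _ => false) x y
  have := Bool.toNat_le (flow e (fun _ => true) (fun _ => false) (x + 1) y).1
  simp only [Bool.toNat_false, add_zero] at h
  unfold stepHeight
  omega

/-- The flow only depends on the decisions at the vertices to the lower left. -/
lemma flow_congr {e e' : ℕ × ℕ → Bool × Bool} : ∀ x y : ℕ,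
    (∀ v : ℕ × ℕ, v.1 < x → v.2 < y → e v = e' v) → flow e L B x y = flow e' L B x y
  | 0, 0, _ => by simp [flow]
  | 0, y + 1, _ => by simp [flow]
  | x + 1, 0, _ => by simp [flow]
  | x + 1, y + 1, h => by
    rw [flow, flow, h (x, y) (by simp) (by simp),
      flow_congr (x + 1) y fun v h1 h2 => h v h1 (by omega),
      flow_congr x (y + 1) fun v h1 h2 => h v (by omega) h2]
termination_by x y => x + y

lemma stepHeight_congr {e e' : ℕ × ℕ → Bool × Bool} (x y : ℕ)
    (h : ∀ v : ℕ × ℕ, v.1 < x → v.2 < y → e v = e' v) : stepHeight e x y = stepHeight e' x y := by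
  unfold stepHeight flux
  exact Finset.sum_congr rfl fun k hk => by
    rw [flow_congr x (k + 1) fun v h1 h2 => h v h1 (by have := Finset.mem_range.1 hk; omega)]

/-- The tiling of the quadrant `ℤ_{≥1}²` with step initial data and local decisions `e`. -/
def tiling (e : ℕ × ℕ → Bool × Bool) (x y : ℕ) : S6VConfig :=
  S6VConfig.ofInputs (e (x - 1, y - 1))
    (flow e (fun _ => true) (fun _ => false) x (y - 1)).1
    (flow e (fun _ => true) (fun _ => false) (x - 1) y).2

lemma leftInput_tiling (e : ℕ × ℕ → Bool × Bool) (x y : ℕ) :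
    leftInput (tiling e) (x + 1) (y + 1) =
      (flow e (fun _ => true) (fun _ => false) x (y + 1)).2 := by
  cases x with
  | zero => simp [leftInput, flow]
  | succ x => simp [leftInput, tiling, flow]

lemma bottomInput_tiling (e : ℕ × ℕ → Bool × Bool) (x y : ℕ) :
    bottomInput (tiling e) (x + 1) (y + 1) =
      (flow e (fun _ => true) (fun _ => false) (x + 1) y).1 := by
  cases y with
  | zero => simp [bottomInput, flow]
  | succ y => simp [bottomInput, tiling, flow]

lemma tiling_eq_ofInputs (e : ℕ × ℕ → Bool × Bool) (x y : ℕ) :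
    tiling e (x + 1) (y + 1) = S6VConfig.ofInputs (e (x, y))
      (bottomInput (tiling e) (x + 1) (y + 1)) (leftInput (tiling e) (x + 1) (y + 1)) := by
  rw [leftInput_tiling, bottomInput_tiling]
  simp [tiling]

lemma height_tiling (e : ℕ × ℕ → Bool × Bool) (x y : ℕ) :
    height (tiling e) x y = stepHeight e x y := by
  unfold height stepHeight flux
  rw [Finset.card_filter, ← Finset.Ico_succ_right_eq_Icc, Nat.succ_eq_succ,
    Finset.sum_Ico_eq_sum_range]
  refine Finset.sum_congr (by simp) fun k _ => ?_
  rw [add_comm 1 k, leftInput_tiling]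
  cases (flow e (fun _ => true) (fun _ => false) x (k + 1)).2 <;> rfl

end S6V

/-! ### Independent coins realize the model. -/

namespace S6V

open ProbabilityTheory

/-- The law of the pair of local decisions at a vertex with parameters `p`, `q`. -/
noncomputable def decisionLaw (p q : unitInterval) : Measure (Bool × Bool) :=
  (bernoulliMeasure true false p).prod (bernoulliMeasure true false q)

instance (p q : unitInterval) : IsProbabilityMeasure (decisionLaw p q) := by
  unfold decisionLaw; infer_instance

/-- The law of independent local decisions with parameters `p`, `q`. -/
noncomputable def envLaw (p q : ℕ × ℕ → unitInterval) : Measure (ℕ × ℕ → Bool × Bool) :=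
  Measure.infinitePi fun v => decisionLaw (p v) (q v)

instance (p q : ℕ × ℕ → unitInterval) : IsProbabilityMeasure (envLaw p q) := by
  unfold envLaw; infer_instance

lemma decisionLaw_ofInputs (p q : unitInterval) (i j : Bool) (t : S6VConfig) :
    decisionLaw p q {u | S6VConfig.ofInputs u i j = t} =
      ENNReal.ofReal (S6VConfig.prob p q i j t) := by
  classical
  have hp : ∀ p : unitInterval, unitInterval.toNNReal p = ENNReal.ofReal p := fun p => by
    rw [ENNReal.ofReal, ENNReal.coe_inj]; ext; simp [p.2.1]
  have hT : ∀ p : unitInterval, bernoulliMeasure true false p {true} = ENNReal.ofReal p := by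
    intro p; rw [bernoulliMeasure_apply _ (by measurability)]; simp [hp]
  have hF : ∀ p : unitInterval, bernoulliMeasure true false p {false} =
      ENNReal.ofReal (1 - p) := by
    intro p; rw [bernoulliMeasure_apply _ (by measurability)]; simp [hp]
  have key : ∀ (A : Set Bool) (C : Set Bool), decisionLaw p q (A ×ˢ C) =
      bernoulliMeasure true false p A * bernoulliMeasure true false q C :=
    fun A C => Measure.prod_prod A C
  have hE : ∀ i j t, (∀ u, S6VConfig.ofInputs u i j ≠ t) →
      {u | S6VConfig.ofInputs u i j = t} = ∅ := fun i j t h => Set.eq_empty_of_forall_notMem h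
  have h1 : {u : Bool × Bool | u.1 = true} = {true} ×ˢ Set.univ := by ext; simp
  have h2 : {u : Bool × Bool | u.1 = false} = {false} ×ˢ Set.univ := by ext; simp
  have h3 : {u : Bool × Bool | u.2 = true} = Set.univ ×ˢ {true} := by ext; simp
  have h4 : {u : Bool × Bool | u.2 = false} = Set.univ ×ˢ {false} := by ext; simp
  cases i <;> cases j <;> cases t <;>
    simp [S6VConfig.ofInputs, S6VConfig.prob, S6VConfig.weight, S6VConfig.bottom, S6VConfig.left,
      ite_eq_iff, h1, h2, h3, h4, key, hT, hF, -unitInterval.coe_toNNReal]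

/-- Such a map factors through a finite discrete space, so any σ-algebra on the target is allowed.
-/
lemma measurable_of_dependsOn {α : Type*} [MeasurableSpace α] [Nonempty α]
    {f : (ℕ × ℕ → Bool × Bool) → α} (S : Finset (ℕ × ℕ)) (hf : DependsOn f S) :
    Measurable f := by
  obtain ⟨g, rfl⟩ := dependsOn_iff_exists_comp.1 hf
  exact (measurable_of_finite g).comp (measurable_pi_lambda _ fun i => measurable_pi_apply _)

lemma indepFun_of_dependsOn {α β : Type*} [MeasurableSpace α] [MeasurableSpace β] [Nonempty α]
    [Nonempty β] (p q : ℕ × ℕ → unitInterval)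
    {f : (ℕ × ℕ → Bool × Bool) → α} {g : (ℕ × ℕ → Bool × Bool) → β} {S T : Finset (ℕ × ℕ)}
    (hST : Disjoint S T) (hf : DependsOn f S) (hg : DependsOn g T) :
    IndepFun f g (envLaw p q) := by
  obtain ⟨f', rfl⟩ := dependsOn_iff_exists_comp.1 hf
  obtain ⟨g', rfl⟩ := dependsOn_iff_exists_comp.1 hg
  have h : iIndepFun (fun v (e : ℕ × ℕ → Bool × Bool) => e v) (envLaw p q) :=
    iIndepFun_infinitePi (X := fun _ u => u) fun _ => measurable_id
  exact (h.indepFun_finset S T hST fun v => measurable_pi_apply v).comp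
    (φ := f') (ψ := g') (measurable_of_finite f') (measurable_of_finite g')

lemma dependsOn_tiling (x y : ℕ) (hx : 1 ≤ x) (hy : 1 ≤ y) {S : Finset (ℕ × ℕ)}
    (hS : ∀ v : ℕ × ℕ, v.1 < x → v.2 < y → v ∈ S) : DependsOn (fun e => tiling e x y) S := by
  intro e e' h
  have h' : ∀ v : ℕ × ℕ, v.1 < x → v.2 < y → e v = e' v :=
    fun v h1 h2 => h v (by exact_mod_cast hS v h1 h2)
  simp only [tiling]
  rw [h' (x - 1, y - 1) (by simp; omega) (by simp; omega),
    flow_congr x (y - 1) fun v h1 h2 => h' v h1 (by omega),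
    flow_congr (x - 1) y fun v h1 h2 => h' v (by omega) h2]

lemma leftInput_congr {c c' : ℕ → ℕ → S6VConfig} {x y : ℕ} (hx : 1 ≤ x) (hy : 1 ≤ y)
    (h : ∀ x' y', Before x' y' x y → c x' y' = c' x' y') :
    leftInput c x y = leftInput c' x y := by
  unfold leftInput
  split_ifs with h1
  · rfl
  · rw [h _ _ ⟨by omega, hy, Or.inl (by omega)⟩]

lemma bottomInput_congr {c c' : ℕ → ℕ → S6VConfig} {x y : ℕ} (hx : 1 ≤ x) (hy : 1 ≤ y)
    (h : ∀ x' y', Before x' y' x y → c x' y' = c' x' y') :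
    bottomInput c x y = bottomInput c' x y := by
  unfold bottomInput
  split_ifs with h1
  · rfl
  · rw [h _ _ ⟨hx, by omega, Or.inl (by omega)⟩]

/-- The tiling made from independent local decisions is a realization of the S6V model. -/
lemma isModel_tiling (b₁ b₂ : ℕ → ℕ → ℝ) (p q : ℕ × ℕ → unitInterval)
    (hp : ∀ x y, (p (x, y) : ℝ) = b₁ (x + 1) (y + 1))
    (hq : ∀ x y, (q (x, y) : ℝ) = b₂ (x + 1) (y + 1)) :
    IsModel b₁ b₂ (envLaw p q) fun x y e => tiling e x y where
  measurable x y hx hy :=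
    haveI : Nonempty S6VConfig := ⟨.empty⟩
    measurable_of_dependsOn (Finset.range x ×ˢ Finset.range y)
      (dependsOn_tiling x y hx hy fun v h1 h2 => by simp [h1, h2])
  sampling x y hx hy c t := by
    obtain ⟨x, rfl⟩ : ∃ n, x = n + 1 := ⟨x - 1, by omega⟩
    obtain ⟨y, rfl⟩ : ∃ n, y = n + 1 := ⟨y - 1, by omega⟩
    set i := bottomInput c (x + 1) (y + 1)
    set j := leftInput c (x + 1) (y + 1)
    -- Once the past agrees with `c`, the inputs are those of `c`, and the new event concerns only
    -- the coins at this vertex.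
    have hset : {e | (∀ x' y', Before x' y' (x + 1) (y + 1) → tiling e x' y' = c x' y') ∧
        tiling e (x + 1) (y + 1) = t} =
        {e | ∀ x' y', Before x' y' (x + 1) (y + 1) → tiling e x' y' = c x' y'} ∩
          (fun e => e (x, y)) ⁻¹' {u | S6VConfig.ofInputs u i j = t} := by
      ext e
      refine and_congr_right fun he => ?_
      rw [tiling_eq_ofInputs, bottomInput_congr hx hy he, leftInput_congr hx hy he]
      rfl
    -- The coins used by the past, with indices lowered by one. A tile uses only coins weakly to its
    -- lower left, so the coins at `(x, y)` are not among them.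
    let S : Finset (ℕ × ℕ) := (Finset.range (x + y + 1) ×ˢ Finset.range (x + y + 1)).filter
      fun v => v.1 + v.2 < x + y ∨ v.1 + v.2 = x + y ∧ v.2 < y
    have hF : DependsOn (fun e : ℕ × ℕ → Bool × Bool =>
        ∀ x' y', Before x' y' (x + 1) (y + 1) → tiling e x' y' = c x' y') S := by
      intro e e' h
      refine propext <| forall₂_congr fun x' y' => forall_congr' fun hb => ?_
      obtain ⟨h1, h2, h3⟩ := hb
      rw [show tiling e x' y' = tiling e' x' y' from dependsOn_tiling x' y' h1 h2
        (S := S) (fun v hv1 hv2 => by simp [S]; omega) h]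
    have hG : DependsOn (fun e : ℕ × ℕ → Bool × Bool => e (x, y)) ({(x, y)} : Finset _) := by
      intro e e' h
      exact h (x, y) (by simp)
    have hI := indepFun_of_dependsOn p q (by simp [S]) hF hG
    have := hI.measure_inter_preimage_eq_mul {P : Prop | P} {u | S6VConfig.ofInputs u i j = t}
      (by measurability) (by measurability)
    rw [hset]
    refine this.trans ?_
    congr 1
    rw [← Measure.map_apply (measurable_pi_apply _) (by measurability), envLaw, Measure.infinitePi_map_eval,
      decisionLaw_ofInputs, hp, hq]

end S6V

/-! ### The sampling rule determines the law on finitely many vertices. -/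

instance : Finite S6VConfig :=
  Finite.of_injective (fun t : S6VConfig => (t.bottom, t.left, t.top, t.right)) fun s t h => by
    cases s <;> cases t <;> first | rfl | (exact absurd h (by decide))

namespace S6V

variable {Ω Ω' : Type*}

/-- The event that `σ` agrees with `c` on the antidiagonals before the `s`-th one and on the
vertices of the `s`-th antidiagonal below height `y`. -/
def prefixEvent (σ : ℕ → ℕ → Ω → S6VConfig) (c : ℕ → ℕ → S6VConfig) (s y : ℕ) : Set Ω :=
  {ω | ∀ x' y', 1 ≤ x' → 1 ≤ y' → (x' + y' < s ∨ x' + y' = s ∧ y' < y) → σ x' y' ω = c x' y'}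

lemma prefixEvent_succ_zero (σ : ℕ → ℕ → Ω → S6VConfig) (c : ℕ → ℕ → S6VConfig) (s : ℕ) :
    prefixEvent σ c (s + 1) 0 = prefixEvent σ c s (s + 1) := by
  ext ω
  refine forall₄_congr fun x' y' _ _ => ?_
  rw [show (x' + y' < s + 1 ∨ x' + y' = s + 1 ∧ y' < 0) ↔
    (x' + y' < s ∨ x' + y' = s ∧ y' < s + 1) by omega]

lemma prefixEvent_succ_succ (σ : ℕ → ℕ → Ω → S6VConfig) (c : ℕ → ℕ → S6VConfig) (x y : ℕ)
    (hx : 1 ≤ x) (hy : 1 ≤ y) :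
    prefixEvent σ c (x + y) (y + 1) =
      {ω | (∀ x' y', Before x' y' x y → σ x' y' ω = c x' y') ∧ σ x y ω = c x y} := by
  ext ω
  constructor
  · exact fun h => ⟨fun x' y' hb => h x' y' hb.1 hb.2.1 (by have := hb.2.2; omega),
      h x y hx hy (by omega)⟩
  · rintro ⟨h1, h2⟩ x' y' hx' hy' h
    by_cases hxy : x' = x ∧ y' = y
    · rw [hxy.1, hxy.2, h2]
    · exact h1 x' y' ⟨hx', hy', by omega⟩

lemma prefixEvent_eq_before (σ : ℕ → ℕ → Ω → S6VConfig) (c : ℕ → ℕ → S6VConfig) (x y : ℕ) :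
    prefixEvent σ c (x + y) y = {ω | ∀ x' y', Before x' y' x y → σ x' y' ω = c x' y'} := by
  ext ω
  exact forall₂_congr fun x' y' => ⟨fun h hb => h hb.1 hb.2.1 hb.2.2, fun h h1 h2 h3 =>
    h ⟨h1, h2, h3⟩⟩

variable [MeasurableSpace Ω] [MeasurableSpace Ω'] {b₁ b₂ : ℕ → ℕ → ℝ}
  {μ : Measure Ω} {μ' : Measure Ω'} {σ : ℕ → ℕ → Ω → S6VConfig} {σ' : ℕ → ℕ → Ω' → S6VConfig}

/-- Chain rule along the sampling order: each new vertex multiplies the probability by a factor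
depending only on `c` and the parameters. -/
lemma IsModel.measure_prefixEvent [IsProbabilityMeasure μ] [IsProbabilityMeasure μ']
    (h : IsModel b₁ b₂ μ σ) (h' : IsModel b₁ b₂ μ' σ') (c : ℕ → ℕ → S6VConfig) (s y : ℕ) :
    μ (prefixEvent σ c s y) = μ' (prefixEvent σ' c s y) := by
  induction s generalizing y with
  | zero =>
    have h0 : ∀ {Ω : Type _} (σ : ℕ → ℕ → Ω → S6VConfig), prefixEvent σ c 0 y = Set.univ :=
      fun σ => Set.eq_univ_of_forall fun ω x' y' _ _ _ => by omega
    have h0' : prefixEvent σ' c 0 y = Set.univ :=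
      Set.eq_univ_of_forall fun ω x' y' _ _ _ => by omega
    rw [h0, h0', measure_univ, measure_univ]
  | succ s ih =>
    induction y with
    | zero => rw [prefixEvent_succ_zero, prefixEvent_succ_zero, ih]
    | succ y ihy =>
      -- Otherwise height `y` carries no vertex of this antidiagonal, and the event does not change.
      by_cases hy : 1 ≤ y ∧ y < s + 1
      · obtain ⟨x, hx⟩ : ∃ x, s + 1 = x + y := ⟨s + 1 - y, by omega⟩
        have hx1 : 1 ≤ x := by omega
        rw [hx, prefixEvent_succ_succ σ c x y hx1 hy.1, prefixEvent_succ_succ σ' c x y hx1 hy.1,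
          h.sampling x y hx1 hy.1, h'.sampling x y hx1 hy.1, ← prefixEvent_eq_before,
          ← prefixEvent_eq_before, ← hx, ihy]
      · have key : ∀ x' y', 1 ≤ x' → 1 ≤ y' → ((x' + y' < s + 1 ∨ x' + y' = s + 1 ∧ y' < y + 1) ↔
            (x' + y' < s + 1 ∨ x' + y' = s + 1 ∧ y' < y)) := by omega
        have e1 : prefixEvent σ c (s + 1) (y + 1) = prefixEvent σ c (s + 1) y := by
          ext ω
          exact forall₄_congr fun x' y' h1 h2 => by rw [key x' y' h1 h2]
        have e2 : prefixEvent σ' c (s + 1) (y + 1) = prefixEvent σ' c (s + 1) y := by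
          ext ω
          exact forall₄_congr fun x' y' h1 h2 => by rw [key x' y' h1 h2]
        rw [e1, e2, ihy]

/-- Two realizations of the model give the same probability to every event that depends on
finitely many vertices. -/
lemma IsModel.measure_eq [IsProbabilityMeasure μ] [IsProbabilityMeasure μ']
    (h : IsModel b₁ b₂ μ σ) (h' : IsModel b₁ b₂ μ' σ') (A : (ℕ → ℕ → S6VConfig) → Prop) (N : ℕ)
    (hA : ∀ c c' : ℕ → ℕ → S6VConfig,
      (∀ x y, 1 ≤ x → 1 ≤ y → x + y < N → c x y = c' x y) → A c → A c') :
    μ {ω | A fun x y => σ x y ω} = μ' {ω | A fun x y => σ' x y ω} := by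
  classical
  let S : Finset (ℕ × ℕ) := (Finset.range N ×ˢ Finset.range N).filter
    fun v => 1 ≤ v.1 ∧ 1 ≤ v.2 ∧ v.1 + v.2 < N
  have hS : ∀ x y, 1 ≤ x → 1 ≤ y → x + y < N → (x, y) ∈ S := by
    intro x y h1 h2 h3
    simp [S]; omega
  have hS' : ∀ v ∈ S, 1 ≤ v.1 ∧ 1 ≤ v.2 ∧ v.1 + v.2 < N := fun v hv => (Finset.mem_filter.1 hv).2
  let ext : (S → S6VConfig) → ℕ → ℕ → S6VConfig :=
    fun r x y => if hv : (x, y) ∈ S then r ⟨(x, y), hv⟩ else .empty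
  let X : Ω → S → S6VConfig := fun ω v => σ v.1.1 v.1.2 ω
  let X' : Ω' → S → S6VConfig := fun ω v => σ' v.1.1 v.1.2 ω
  have hX : Measurable X := measurable_pi_lambda _ fun v =>
    h.measurable _ _ (hS' v.1 v.2).1 (hS' v.1 v.2).2.1
  have hX' : Measurable X' := measurable_pi_lambda _ fun v =>
    h'.measurable _ _ (hS' v.1 v.2).1 (hS' v.1 v.2).2.1
  have hset : {ω | A fun x y => σ x y ω} = X ⁻¹' {r | A (ext r)} := by
    ext ω
    constructor <;> refine hA _ _ fun x y h1 h2 h3 => ?_ <;> simp [ext, hS x y h1 h2 h3, X]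
  have hset' : {ω | A fun x y => σ' x y ω} = X' ⁻¹' {r | A (ext r)} := by
    ext ω
    constructor <;> refine hA _ _ fun x y h1 h2 h3 => ?_ <;> simp [ext, hS x y h1 h2 h3, X']
  -- The atoms of the finite vector `X` are prefix events, so its law is determined; the filler
  -- `.empty` in `ext` lies outside the vertices concerned.
  have hpre : ∀ r, X ⁻¹' {r} = prefixEvent σ (ext r) N 0 := by
    intro r
    ext ω
    constructor
    · rintro rfl x y h1 h2 h3
      simp [ext, hS x y h1 h2 (by omega), X]
    · intro hω
      funext v
      have := hω v.1.1 v.1.2 (hS' v.1 v.2).1 (hS' v.1 v.2).2.1 (Or.inl (hS' v.1 v.2).2.2)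
      simpa [ext] using this
  have hpre' : ∀ r, X' ⁻¹' {r} = prefixEvent σ' (ext r) N 0 := by
    intro r
    ext ω
    constructor
    · rintro rfl x y h1 h2 h3
      simp [ext, hS x y h1 h2 (by omega), X']
    · intro hω
      funext v
      have := hω v.1.1 v.1.2 (hS' v.1 v.2).1 (hS' v.1 v.2).2.1 (Or.inl (hS' v.1 v.2).2.2)
      simpa [ext] using this
  have hmap : μ.map X = μ'.map X' := Measure.ext_of_singleton fun r => by
    rw [Measure.map_apply hX (measurableSet_singleton r),
      Measure.map_apply hX' (measurableSet_singleton r), hpre, hpre',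
      h.measure_prefixEvent h']
  have hm : MeasurableSet {r | A (ext r)} := (Set.toFinite _).measurableSet
  rw [hset, hset', ← Measure.map_apply hX hm, ← Measure.map_apply hX' hm, hmap]

lemma height_congr {c c' : ℕ → ℕ → S6VConfig} {x y : ℕ}
    (h : ∀ x' y', 1 ≤ x' → 1 ≤ y' → x' + y' < x + y + 1 → c x' y' = c' x' y') :
    height c x y = height c' x y := by
  unfold height
  congr 1
  refine Finset.filter_congr fun k hk => ?_
  rw [Finset.mem_Icc] at hk
  unfold leftInput
  split_ifs with hx
  · rfl
  · rw [Nat.add_sub_cancel, h x k (by omega) hk.1 (by omega)]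

end S6V

/-! ### Moments of the height and concentration along dyadic sequences. -/

namespace S6V

open ProbabilityTheory

lemma stepHeight_le (e : ℕ × ℕ → Bool × Bool) (x y : ℕ) : stepHeight e x y ≤ y := by
  induction y with
  | zero => simp [stepHeight, flux]
  | succ y ih => have := (stepHeight_succ_right e x y).2; omega

lemma dependsOn_stepHeight (x y : ℕ) :
    DependsOn (fun e => stepHeight e x y) (Finset.range x ×ˢ Finset.range y : Finset (ℕ × ℕ)) :=
  fun _ _ h => stepHeight_congr x y fun v h1 h2 => h v (by simp [h1, h2])

lemma measurable_stepHeight (x y : ℕ) : Measurable fun e => (stepHeight e x y : ℝ) :=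
  measurable_from_nat.comp (measurable_of_dependsOn _ (dependsOn_stepHeight x y))

variable (p q : ℕ × ℕ → unitInterval)

lemma memLp_stepHeight (x y : ℕ) :
    MemLp (fun e => (stepHeight e x y : ℝ)) 2 (envLaw p q) :=
  MemLp.of_bound (measurable_stepHeight x y).aestronglyMeasurable y <| ae_of_all _ fun e => by
    rw [Real.norm_of_nonneg (by positivity)]
    exact_mod_cast stepHeight_le e x y

lemma integrable_stepHeight (x y : ℕ) :
    Integrable (fun e => (stepHeight e x y : ℝ)) (envLaw p q) :=
  (memLp_stepHeight p q x y).integrable (by norm_num)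

/-- The expectation of the height function. -/
noncomputable def meanHeight (x y : ℕ) : ℝ := ∫ e, (stepHeight e x y : ℝ) ∂envLaw p q

lemma meanHeight_nonneg (x y : ℕ) : 0 ≤ meanHeight p q x y :=
  integral_nonneg fun _ => by positivity

variable {p q}

lemma measurePreserving_shift {a b : ℕ} (hp : ∀ v : ℕ × ℕ, p (a + v.1, b + v.2) = p v)
    (hq : ∀ v : ℕ × ℕ, q (a + v.1, b + v.2) = q v) :
    MeasurePreserving (fun (e : ℕ × ℕ → Bool × Bool) (v : ℕ × ℕ) => e (a + v.1, b + v.2))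
      (envLaw p q) (envLaw p q) where
  measurable := measurable_pi_lambda _ fun _ => measurable_pi_apply _
  map_eq := by
    have := Measure.map_infinitePi_infinitePi_of_inj
      (P := fun v => decisionLaw (p v) (q v)) (f := fun v : ℕ × ℕ => (a + v.1, b + v.2))
      (fun v w h => by simpa [Prod.ext_iff] using h)
    simpa only [hp, hq, envLaw] using this

lemma integral_shift {a b : ℕ} (hp : ∀ v : ℕ × ℕ, p (a + v.1, b + v.2) = p v)
    (hq : ∀ v : ℕ × ℕ, q (a + v.1, b + v.2) = q v)
    (f : (ℕ × ℕ → Bool × Bool) → ℝ) (hf : Measurable f) :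
    ∫ e, f (fun v => e (a + v.1, b + v.2)) ∂envLaw p q = ∫ e, f e ∂envLaw p q := by
  have h := measurePreserving_shift hp hq
  rw [← integral_map (f := f) h.measurable.aemeasurable hf.aestronglyMeasurable, h.map_eq]

lemma memLp_stepHeight_shift {a b : ℕ} (hp : ∀ v : ℕ × ℕ, p (a + v.1, b + v.2) = p v)
    (hq : ∀ v : ℕ × ℕ, q (a + v.1, b + v.2) = q v) (x y : ℕ) :
    MemLp (fun e : ℕ × ℕ → Bool × Bool =>
      (stepHeight (fun v => e (a + v.1, b + v.2)) x y : ℝ)) 2 (envLaw p q) :=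
  (memLp_stepHeight p q x y).comp_measurePreserving (measurePreserving_shift hp hq)

lemma meanHeight_add_le {a b : ℕ} (hp : ∀ v : ℕ × ℕ, p (a + v.1, b + v.2) = p v)
    (hq : ∀ v : ℕ × ℕ, q (a + v.1, b + v.2) = q v) (x y : ℕ) :
    meanHeight p q (a + x) (b + y) ≤ meanHeight p q a b + meanHeight p q x y := by
  have hi := (memLp_stepHeight_shift hp hq x y).integrable (by norm_num)
  unfold meanHeight
  rw [← integral_shift hp hq _ (measurable_stepHeight x y),
    ← integral_add (integrable_stepHeight p q a b) hi]
  refine integral_mono (integrable_stepHeight p q _ _)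
    ((integrable_stepHeight p q a b).add hi) fun e => ?_
  have := stepHeight_add_le e a b x y
  rify at this
  exact this

/-- By subadditivity the height at the doubled point is at most `Y + Y'`, where `Y'` is a copy of
`Y` using disjoint coins, hence independent. Heights are nonnegative, so the bound can be squared.
-/
lemma integral_sq_stepHeight_le {a b : ℕ} (hp : ∀ v : ℕ × ℕ, p (a + v.1, b + v.2) = p v)
    (hq : ∀ v : ℕ × ℕ, q (a + v.1, b + v.2) = q v) :
    ∫ e, (stepHeight e (a + a) (b + b) : ℝ) ^ 2 ∂envLaw p q ≤
      2 * ∫ e, (stepHeight e a b : ℝ) ^ 2 ∂envLaw p q + 2 * meanHeight p q a b ^ 2 := by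
  set Y : (ℕ × ℕ → Bool × Bool) → ℝ := fun e => stepHeight e a b with hY
  set Y' : (ℕ × ℕ → Bool × Bool) → ℝ :=
    fun e => stepHeight (fun v => e (a + v.1, b + v.2)) a b with hY'
  have hm : MemLp Y 2 (envLaw p q) := memLp_stepHeight p q a b
  have hm' : MemLp Y' 2 (envLaw p q) := memLp_stepHeight_shift hp hq a b
  have hind : IndepFun Y Y' (envLaw p q) := by
    refine indepFun_of_dependsOn p q (S := Finset.range a ×ˢ Finset.range b)
      (T := (Finset.range a ×ˢ Finset.range b).image fun v => (a + v.1, b + v.2)) ?_ ?_ ?_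
    · rw [Finset.disjoint_left]
      rintro v hv hv'
      obtain ⟨w, -, rfl⟩ := Finset.mem_image.1 hv'
      simp at hv
    · intro e e' h
      simp only [hY, dependsOn_stepHeight a b h]
    · intro e e' h
      have := @dependsOn_stepHeight a b (fun v : ℕ × ℕ => e (a + v.1, b + v.2))
        (fun v : ℕ × ℕ => e' (a + v.1, b + v.2))
        fun v hv => h _ (Finset.mem_coe.2 (Finset.mem_image_of_mem _ hv))
      simp only [hY']
      exact_mod_cast this
  have hmul : ∫ e, Y e * Y' e ∂envLaw p q = meanHeight p q a b ^ 2 := by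
    rw [hind.integral_fun_mul_eq_mul_integral hm.aestronglyMeasurable hm'.aestronglyMeasurable,
      sq, meanHeight, hY', integral_shift hp hq _ (measurable_stepHeight a b)]
  have hsq : ∫ e, Y' e ^ 2 ∂envLaw p q = ∫ e, Y e ^ 2 ∂envLaw p q :=
    integral_shift hp hq (fun e => Y e ^ 2) ((measurable_stepHeight a b).pow_const 2)
  have hYY' : Integrable (fun e => Y e * Y' e) (envLaw p q) := hm.integrable_mul hm'
  calc ∫ e, (stepHeight e (a + a) (b + b) : ℝ) ^ 2 ∂envLaw p q
      ≤ ∫ e, (Y e ^ 2 + Y' e ^ 2 + 2 * (Y e * Y' e)) ∂envLaw p q := by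
        refine integral_mono (memLp_stepHeight p q _ _).integrable_sq
          ((hm.integrable_sq.add hm'.integrable_sq).add (hYY'.const_mul 2)) fun e => ?_
        have h : (stepHeight e (a + a) (b + b) : ℝ) ≤ Y e + Y' e := by
          simp only [hY, hY']
          exact_mod_cast stepHeight_add_le e a b a b
        have := pow_le_pow_left₀ (Nat.cast_nonneg _) h 2
        dsimp only
        linarith [add_sq (Y e) (Y' e)]
    _ = 2 * ∫ e, Y e ^ 2 ∂envLaw p q + 2 * meanHeight p q a b ^ 2 := by
        rw [integral_add (f := fun e => Y e ^ 2 + Y' e ^ 2)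
          (hm.integrable_sq.add hm'.integrable_sq) (hYY'.const_mul 2),
          integral_add hm.integrable_sq hm'.integrable_sq, integral_const_mul, hmul, hsq]
        ring

/-- The variances of the height function along a dyadic sequence of lattice points, divided by
the squared scale, are summable. -/
lemma summable_variance {a b : ℕ}
    (hp : ∀ k : ℕ, ∀ v : ℕ × ℕ, p (2 ^ k * a + v.1, 2 ^ k * b + v.2) = p v)
    (hq : ∀ k : ℕ, ∀ v : ℕ × ℕ, q (2 ^ k * a + v.1, 2 ^ k * b + v.2) = q v) :
    Summable fun k : ℕ =>
      Var[fun e => (stepHeight e (2 ^ k * a) (2 ^ k * b) : ℝ); envLaw p q] / (2 ^ k) ^ 2 := by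
  set s : ℕ → ℝ := fun k =>
    (∫ e, (stepHeight e (2 ^ k * a) (2 ^ k * b) : ℝ) ^ 2 ∂envLaw p q) / (2 ^ k) ^ 2
  set v : ℕ → ℝ := fun k =>
    Var[fun e => (stepHeight e (2 ^ k * a) (2 ^ k * b) : ℝ); envLaw p q] / (2 ^ k) ^ 2
  have hs : ∀ k, 0 ≤ s k := fun k => by
    have : 0 ≤ ∫ e, (stepHeight e (2 ^ k * a) (2 ^ k * b) : ℝ) ^ 2 ∂envLaw p q :=
      integral_nonneg fun e => by positivity
    positivity
  -- Writing the squared mean as second moment minus variance, the doubling bound is 4 E H² - 2 Var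
  -- H; doubling the scale divides it by 4.
  have hstep : ∀ k, s (k + 1) ≤ s k - v k / 2 := by
    intro k
    have h := integral_sq_stepHeight_le (hp k) (hq k)
    have hv : Var[fun e => (stepHeight e (2 ^ k * a) (2 ^ k * b) : ℝ); envLaw p q] =
        ∫ e, (stepHeight e (2 ^ k * a) (2 ^ k * b) : ℝ) ^ 2 ∂envLaw p q -
          meanHeight p q (2 ^ k * a) (2 ^ k * b) ^ 2 := by
      rw [variance_eq_sub (memLp_stepHeight p q _ _)]
      rfl
    have e1 : ∀ c : ℕ, 2 ^ (k + 1) * c = 2 ^ k * c + 2 ^ k * c := fun c => by ring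
    simp only [s, v, e1, hv]
    have h2 : (0 : ℝ) < (2 ^ k) ^ 2 := by positivity
    rw [pow_succ (2 : ℝ) k, mul_pow, div_le_iff₀ (by positivity)]
    refine h.trans (le_of_eq ?_)
    field_simp
    ring
  refine summable_of_sum_range_le (c := 2 * s 0) (fun k => ?_) fun n => ?_
  · exact div_nonneg (variance_nonneg _ _) (by positivity)
  · have : ∀ n, ∑ i ∈ Finset.range n, v i ≤ 2 * s 0 - 2 * s n := by
      intro n
      induction n with
      | zero => simp
      | succ n ih => rw [Finset.sum_range_succ]; linarith [hstep n]
    linarith [this n, hs n]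

lemma tsum_deviation_ne_top {a b : ℕ}
    (hp : ∀ k : ℕ, ∀ v : ℕ × ℕ, p (2 ^ k * a + v.1, 2 ^ k * b + v.2) = p v)
    (hq : ∀ k : ℕ, ∀ v : ℕ × ℕ, q (2 ^ k * a + v.1, 2 ^ k * b + v.2) = q v)
    {ε : ℝ} (hε : 0 < ε) :
    ∑' k : ℕ, envLaw p q {e | ε * 2 ^ k ≤ |(stepHeight e (2 ^ k * a) (2 ^ k * b) : ℝ) -
      meanHeight p q (2 ^ k * a) (2 ^ k * b)|} ≠ ⊤ := by
  have h := ((summable_variance hp hq).mul_right (1 / ε ^ 2)).tsum_ofReal_ne_top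
  refine ne_top_of_le_ne_top h (ENNReal.tsum_le_tsum fun k => ?_)
  refine (meas_ge_le_variance_div_sq (memLp_stepHeight p q _ _) (by positivity)).trans
    (le_of_eq ?_)
  congr 1
  field_simp

lemma meanHeight_succ_left (x y : ℕ) :
    |meanHeight p q (x + 1) y - meanHeight p q x y| ≤ 1 := by
  have hi := integrable_stepHeight p q
  have h1 : meanHeight p q (x + 1) y ≤ meanHeight p q x y :=
    integral_mono (hi _ _) (hi _ _) fun e => Nat.cast_le.2 (stepHeight_succ_left e x y).1
  have h2 : meanHeight p q x y ≤ meanHeight p q (x + 1) y + 1 := by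
    have := integral_mono (μ := envLaw p q) (hi x y) ((hi (x + 1) y).add (integrable_const (1 : ℝ)))
      fun e => by
        simp only [Pi.add_apply]
        exact_mod_cast (stepHeight_succ_left e x y).2
    rw [integral_add' (hi _ _) (integrable_const _)] at this
    simpa [meanHeight] using this
  rw [abs_le]
  constructor <;> linarith

lemma meanHeight_succ_right (x y : ℕ) :
    |meanHeight p q x (y + 1) - meanHeight p q x y| ≤ 1 := by
  have hi := integrable_stepHeight p q
  have h1 : meanHeight p q x y ≤ meanHeight p q x (y + 1) :=
    integral_mono (hi _ _) (hi _ _) fun e => Nat.cast_le.2 (stepHeight_succ_right e x y).1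
  have h2 : meanHeight p q x (y + 1) ≤ meanHeight p q x y + 1 := by
    have := integral_mono (μ := envLaw p q) (hi x (y + 1)) ((hi x y).add (integrable_const (1 : ℝ)))
      fun e => by
        simp only [Pi.add_apply]
        exact_mod_cast (stepHeight_succ_right e x y).2
    rw [integral_add' (hi _ _) (integrable_const _)] at this
    simpa [meanHeight] using this
  rw [abs_le]
  constructor <;> linarith

section Realization

variable {Ω : Type*} [MeasurableSpace Ω] {μ : Measure Ω} [IsProbabilityMeasure μ]
  {b₁ b₂ : ℕ → ℕ → ℝ} {σ : ℕ → ℕ → Ω → S6VConfig}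

/-- A realization respects its input lines only almost surely, so the pathwise bounds are
transferred from the coin model, where the bad event is empty. -/
lemma IsModel.ae_abs_height_sub_le (h : IsModel b₁ b₂ μ σ)
    (hp : ∀ x y, (p (x, y) : ℝ) = b₁ (x + 1) (y + 1))
    (hq : ∀ x y, (q (x, y) : ℝ) = b₂ (x + 1) (y + 1)) :
    ∀ᵐ ω ∂μ, ∀ x y : ℕ,
      |(height (fun i j => σ i j ω) (x + 1) y : ℝ) - height (fun i j => σ i j ω) x y| ≤ 1 ∧
      |(height (fun i j => σ i j ω) x (y + 1) : ℝ) - height (fun i j => σ i j ω) x y| ≤ 1 := by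
  rw [ae_all_iff]
  intro x
  rw [ae_all_iff]
  intro y
  have key := h.measure_eq (isModel_tiling b₁ b₂ p q hp hq)
    (fun c => ¬ (|(height c (x + 1) y : ℝ) - height c x y| ≤ 1 ∧
      |(height c x (y + 1) : ℝ) - height c x y| ≤ 1)) (x + y + 2) (by
        intro c c' hcc'
        rw [height_congr (x := x + 1) (y := y) fun x' y' h1 h2 h3 => hcc' x' y' h1 h2 (by omega),
          height_congr (x := x) (y := y + 1) fun x' y' h1 h2 h3 => hcc' x' y' h1 h2 (by omega),
          height_congr (x := x) (y := y) fun x' y' h1 h2 h3 => hcc' x' y' h1 h2 (by omega)]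
        exact id)
  rw [ae_iff, key, ← nonpos_iff_eq_zero]
  refine (measure_mono (t := ∅) fun e (he : ¬ _) => he ?_).trans (by simp)
  change |(height (tiling e) (x + 1) y : ℝ) - height (tiling e) x y| ≤ 1 ∧
      |(height (tiling e) x (y + 1) : ℝ) - height (tiling e) x y| ≤ 1
  rw [height_tiling, height_tiling, height_tiling]
  obtain ⟨h1, h2⟩ := stepHeight_succ_left e x y
  obtain ⟨h3, h4⟩ := stepHeight_succ_right e x y
  rify at h1 h2 h3 h4
  simp only [abs_le]
  refine ⟨⟨?_, ?_⟩, ?_, ?_⟩ <;> linarith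

/-- Borel–Cantelli for the countably many thresholds 1/(m+1), with the deviation probabilities
computed in the coin model. -/
lemma IsModel.ae_tendsto_dyadic (h : IsModel b₁ b₂ μ σ)
    (hp : ∀ x y, (p (x, y) : ℝ) = b₁ (x + 1) (y + 1))
    (hq : ∀ x y, (q (x, y) : ℝ) = b₂ (x + 1) (y + 1)) {a b : ℕ}
    (hpp : ∀ k : ℕ, ∀ v : ℕ × ℕ, p (2 ^ k * a + v.1, 2 ^ k * b + v.2) = p v)
    (hqp : ∀ k : ℕ, ∀ v : ℕ × ℕ, q (2 ^ k * a + v.1, 2 ^ k * b + v.2) = q v) :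
    ∀ᵐ ω ∂μ, Tendsto (fun k : ℕ => ((height (fun i j => σ i j ω) (2 ^ k * a) (2 ^ k * b) : ℝ) -
      meanHeight p q (2 ^ k * a) (2 ^ k * b)) / 2 ^ k) atTop (𝓝 0) := by
  have hev : ∀ᵐ ω ∂μ, ∀ m : ℕ, ∀ᶠ k : ℕ in atTop,
      |(height (fun i j => σ i j ω) (2 ^ k * a) (2 ^ k * b) : ℝ) -
        meanHeight p q (2 ^ k * a) (2 ^ k * b)| < 1 / ((m : ℝ) + 1) * 2 ^ k := by
    rw [ae_all_iff]
    intro m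
    have hsum := tsum_deviation_ne_top hpp hqp (ε := 1 / ((m : ℝ) + 1)) (by positivity)
    have heq : ∀ k : ℕ, μ {ω | 1 / ((m : ℝ) + 1) * 2 ^ k ≤
        |(height (fun i j => σ i j ω) (2 ^ k * a) (2 ^ k * b) : ℝ) -
          meanHeight p q (2 ^ k * a) (2 ^ k * b)|} =
        envLaw p q {e | 1 / ((m : ℝ) + 1) * 2 ^ k ≤ |(stepHeight e (2 ^ k * a) (2 ^ k * b) : ℝ) -
          meanHeight p q (2 ^ k * a) (2 ^ k * b)|} := by
      intro k
      have := h.measure_eq (isModel_tiling b₁ b₂ p q hp hq)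
        (fun c => 1 / ((m : ℝ) + 1) * 2 ^ k ≤ |(height c (2 ^ k * a) (2 ^ k * b) : ℝ) -
          meanHeight p q (2 ^ k * a) (2 ^ k * b)|) (2 ^ k * a + 2 ^ k * b + 1) (by
            intro c c' hcc'
            rw [height_congr hcc']
            exact id)
      rw [this]
      change envLaw p q {e | 1 / ((m : ℝ) + 1) * 2 ^ k ≤
        |(height (tiling e) (2 ^ k * a) (2 ^ k * b) : ℝ) -
          meanHeight p q (2 ^ k * a) (2 ^ k * b)|} = _
      simp only [height_tiling]
    simp_rw [← heq] at hsum
    filter_upwards [ae_eventually_notMem hsum] with ω hω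
    filter_upwards [hω] with k hk
    exact not_le.1 hk
  filter_upwards [hev] with ω hω
  rw [Metric.tendsto_nhds]
  intro ε hε
  obtain ⟨m, hm⟩ := exists_nat_one_div_lt hε
  filter_upwards [hω m] with k hk
  have h2 : (0 : ℝ) < 2 ^ k := by positivity
  rw [Real.dist_eq, sub_zero, abs_div, abs_of_pos h2, div_lt_iff₀ h2]
  exact hk.trans (mul_lt_mul_of_pos_right hm h2)

end Realization

end S6V

/-! ### Deterministic limits: from dyadic lattice points to rays, and Fekete's lemma with rounding.
-/

namespace S6V

lemma abs_sub_le_of_succ {D : ℕ → ℕ → ℝ} {C : ℝ} (h1 : ∀ x y, |D (x + 1) y - D x y| ≤ C)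
    (h2 : ∀ x y, |D x (y + 1) - D x y| ≤ C) (x y x' y' : ℕ) :
    |D x y - D x' y'| ≤ C * (|(x : ℝ) - x'| + |(y : ℝ) - y'|) := by
  have key : ∀ f : ℕ → ℝ, (∀ n, |f (n + 1) - f n| ≤ C) → ∀ m n : ℕ, |f m - f n| ≤
      C * |(m : ℝ) - n| := by
    intro f hf
    have hle : ∀ n k : ℕ, |f (n + k) - f n| ≤ C * k := by
      intro n k
      induction k with
      | zero => simp
      | succ k ih =>
        have := abs_sub_le (f (n + (k + 1))) (f (n + k)) (f n)
        have h' := hf (n + k)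
        push_cast
        rw [← add_assoc] at *
        linarith
    intro m n
    rcases le_total m n with hmn | hmn
    · obtain ⟨k, rfl⟩ := Nat.exists_eq_add_of_le hmn
      rw [abs_sub_comm, abs_sub_comm (m : ℝ)]
      simpa using hle m k
    · obtain ⟨k, rfl⟩ := Nat.exists_eq_add_of_le hmn
      simpa using hle n k
  have e1 := key (fun x => D x y) (fun n => h1 n y) x x'
  have e2 := key (fun y => D x' y) (fun n => h2 x' n) y y'
  have := abs_sub_le (D x y) (D x' y) (D x' y')
  linarith

/-- Replacing n by sN costs at most sx, rounding Nx down to a multiple of I costs sI, and the outer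
floor costs 1. -/
lemma abs_floor_sub_dyadic_le {x : ℝ} (hx : 0 ≤ x) {I : ℕ} (hI : 1 ≤ I) {n s N : ℕ}
    (h1 : s * N ≤ n) (h2 : n < s * (N + 1)) :
    |(⌊(n : ℝ) * x⌋₊ : ℝ) - ((s * (⌊(N : ℝ) * x / I⌋₊ * I) : ℕ) : ℝ)| ≤ s * (x + I) + 1 := by
  have hI' : (0 : ℝ) < I := by exact_mod_cast hI
  have a1 := Nat.floor_le (a := (n : ℝ) * x) (by positivity)
  have a2 := Nat.lt_floor_add_one ((n : ℝ) * x)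
  have c1 := Nat.floor_le (a := (N : ℝ) * x / I) (by positivity)
  have c2 := Nat.lt_floor_add_one ((N : ℝ) * x / I)
  rw [le_div_iff₀ hI'] at c1
  rw [div_lt_iff₀ hI'] at c2
  set f : ℝ := (⌊(N : ℝ) * x / I⌋₊ : ℝ)
  have hs : (0 : ℝ) ≤ s := by positivity
  have d1 := mul_le_mul_of_nonneg_left c1 hs
  have d2 := mul_le_mul_of_nonneg_left c2.le hs
  have h1' : (s : ℝ) * N ≤ n := by exact_mod_cast h1
  have h2' : (n : ℝ) ≤ s * (N + 1) := by exact_mod_cast h2.le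
  have e1 := mul_le_mul_of_nonneg_right h1' hx
  have e2 := mul_le_mul_of_nonneg_right h2' hx
  push_cast
  rw [abs_le]
  have hsx : 0 ≤ (s : ℝ) * x := by positivity
  have hsI : 0 ≤ (s : ℝ) * I := by positivity
  constructor <;> nlinarith

/-- A Lipschitz function on the quadrant which is sublinear along dyadic multiples of the points
of a sublattice is sublinear along every ray. -/
lemma tendsto_floor_of_tendsto_dyadic {D : ℕ → ℕ → ℝ} {C : ℝ}
    (hD : ∀ x y x' y' : ℕ, |D x y - D x' y'| ≤ C * (|(x : ℝ) - x'| + |(y : ℝ) - y'|))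
    {I J : ℕ} (hI : 1 ≤ I) (hJ : 1 ≤ J)
    (h : ∀ r s : ℕ, Tendsto (fun k : ℕ => D (2 ^ k * (r * I)) (2 ^ k * (s * J)) / 2 ^ k) atTop (𝓝 0))
    {x y : ℝ} (hx : 0 ≤ x) (hy : 0 ≤ y) :
    Tendsto (fun n : ℕ => D ⌊(n : ℝ) * x⌋₊ ⌊(n : ℝ) * y⌋₊ / n) atTop (𝓝 0) := by
  have hC : 0 ≤ C := by simpa using (abs_nonneg _).trans (hD 0 0 1 0)
  rw [Metric.tendsto_atTop]
  intro ε hε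
  -- For n ≥ 2^k M the approximation error, at most 2^k C(x+y+I+J+2), is below nε/2.
  obtain ⟨M, hM⟩ := exists_nat_gt (C * (x + y + I + J + 2) / (ε / 2))
  rw [div_lt_iff₀ (by positivity)] at hM
  have hM0 : 0 < M := by
    rcases Nat.eq_zero_or_pos M with rfl | h0
    · have : 0 ≤ C * (x + y + I + J + 2) := by positivity
      simp only [Nat.cast_zero, zero_mul] at hM
      linarith
    · exact h0
  -- Only finitely many lattice points are needed at each scale, so one threshold K serves them all.
  have hev : ∀ᶠ k : ℕ in atTop, ∀ N ∈ Finset.range (2 * M),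
      |D (2 ^ k * (⌊(N : ℝ) * x / I⌋₊ * I)) (2 ^ k * (⌊(N : ℝ) * y / J⌋₊ * J))| < ε / 2 * 2 ^ k := by
    rw [Finset.eventually_all]
    intro N _
    filter_upwards [Metric.tendsto_nhds.1 (h ⌊(N : ℝ) * x / I⌋₊ ⌊(N : ℝ) * y / J⌋₊) (ε / 2)
      (by positivity)] with k hk
    have h2 : (0 : ℝ) < 2 ^ k := by positivity
    rwa [Real.dist_eq, sub_zero, abs_div, abs_of_pos h2, div_lt_iff₀ h2] at hk
  obtain ⟨K, hK⟩ := eventually_atTop.1 hev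
  refine ⟨M * 2 ^ K, fun n hn => ?_⟩
  have hq : 2 ^ K ≤ n / M := (Nat.le_div_iff_mul_le hM0).2 (by rwa [mul_comm])
  have hq0 : n / M ≠ 0 := by have := Nat.two_pow_pos K; omega
  -- The scale with 2^k M ≤ n < 2^(k+1) M, so that N = ⌊n/2^k⌋ < 2M.
  set k := Nat.log 2 (n / M)
  have hKk : K ≤ k := Nat.le_log_of_pow_le (by norm_num) hq
  have hk1 : 2 ^ k * M ≤ n := (Nat.le_div_iff_mul_le hM0).1 (Nat.pow_log_le_self 2 hq0)
  have hk2 : n < 2 ^ k * (2 * M) := by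
    have := (Nat.div_lt_iff_lt_mul hM0).1 (Nat.lt_pow_succ_log_self (b := 2) (by norm_num) (n / M))
    calc n < 2 ^ (k + 1) * M := this
      _ = _ := by ring
  have hkpos : 0 < 2 ^ k := Nat.two_pow_pos k
  set N := n / 2 ^ k
  have hN : N < 2 * M := (Nat.div_lt_iff_lt_mul hkpos).2 (by rwa [mul_comm])
  have hN1 : 2 ^ k * N ≤ n := Nat.mul_div_le n (2 ^ k)
  have hN2 : n < 2 ^ k * (N + 1) := Nat.lt_mul_div_succ n hkpos
  have b0 := hK k hKk N (Finset.mem_range.2 hN)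
  have b1 := abs_floor_sub_dyadic_le hx hI hN1 hN2
  have b2 := abs_floor_sub_dyadic_le hy hJ hN1 hN2
  have b3 := hD ⌊(n : ℝ) * x⌋₊ ⌊(n : ℝ) * y⌋₊ (2 ^ k * (⌊(N : ℝ) * x / I⌋₊ * I))
    (2 ^ k * (⌊(N : ℝ) * y / J⌋₊ * J))
  have b4 := mul_le_mul_of_nonneg_left (add_le_add b1 b2) hC
  have b5 := abs_sub_abs_le_abs_sub (D ⌊(n : ℝ) * x⌋₊ ⌊(n : ℝ) * y⌋₊)
    (D (2 ^ k * (⌊(N : ℝ) * x / I⌋₊ * I)) (2 ^ k * (⌊(N : ℝ) * y / J⌋₊ * J)))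
  have hnpos : (0 : ℝ) < n := by
    have : 0 < 2 ^ k * M := by positivity
    exact_mod_cast this.trans_le hk1
  have hk1' : (2 : ℝ) ^ k * M ≤ n := by exact_mod_cast hk1
  have hM1 : (1 : ℝ) ≤ M := by exact_mod_cast hM0
  have h2k : (1 : ℝ) ≤ 2 ^ k := one_le_pow₀ (by norm_num)
  rw [Real.dist_eq, sub_zero, abs_div, abs_of_pos hnpos, div_lt_iff₀ hnpos]
  have b6 : C * (2 ^ k * (x + I) + 1 + (2 ^ k * (y + J) + 1)) ≤
      2 ^ k * (C * (x + y + I + J + 2)) := by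
    have := mul_le_mul_of_nonneg_left h2k hC
    nlinarith
  have b7 := mul_le_mul_of_nonneg_left hM.le (zero_le_one.trans h2k)
  have b8 : (2 : ℝ) ^ k ≤ 2 ^ k * M := le_mul_of_one_le_right (by positivity) hM1
  have b9 := mul_le_mul_of_nonneg_left hk1' (half_pos hε).le
  have b10 := mul_le_mul_of_nonneg_left b8 (half_pos hε).le
  push_cast at b3 b4
  linarith

/-- A nonnegative Lipschitz function on the quadrant which is subadditive with respect to the
points of a sublattice has a limit along every ray. -/
lemma exists_tendsto_floor_of_subadditive {m : ℕ → ℕ → ℝ} (hm0 : ∀ x y, 0 ≤ m x y)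
    (hm : ∀ x y x' y' : ℕ, |m x y - m x' y'| ≤ 1 * (|(x : ℝ) - x'| + |(y : ℝ) - y'|))
    {I J : ℕ} (hI : 1 ≤ I) (hJ : 1 ≤ J)
    (hsub : ∀ r s x y : ℕ, m (r * I + x) (s * J + y) ≤ m (r * I) (s * J) + m x y)
    {x y : ℝ} (hx : 0 ≤ x) (hy : 0 ≤ y) :
    ∃ l : ℝ, Tendsto (fun n : ℕ => m ⌊(n : ℝ) * x⌋₊ ⌊(n : ℝ) * y⌋₊ / n) atTop (𝓝 l) := by
  -- The total rounding cost: I + (I+1) horizontally and J + (J+1) vertically. Added to the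
  -- sequence, it occurs once on the left of the subadditive inequality and twice on the right,
  -- which absorbs the cost.
  set C : ℝ := 2 * I + 2 * J + 2 with hCdef
  set u : ℕ → ℝ := fun n => m ⌊(n : ℝ) * x⌋₊ ⌊(n : ℝ) * y⌋₊ + C with hu
  have hC : 0 ≤ C := by positivity
  -- Split the coordinate at the last multiple of the period not exceeding ⌊ix⌋, since restarts are
  -- allowed only at lattice points.
  have key : ∀ {I : ℕ}, 1 ≤ I → ∀ {x : ℝ}, 0 ≤ x → ∀ i j : ℕ, ∃ r t : ℕ,
      r * I + t = ⌊((i + j : ℕ) : ℝ) * x⌋₊ ∧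
      |((r * I : ℕ) : ℝ) - ⌊(i : ℝ) * x⌋₊| ≤ I ∧ |(t : ℝ) - ⌊(j : ℝ) * x⌋₊| ≤ I + 1 := by
    intro I hI x hx i j
    have hf : ⌊(i : ℝ) * x⌋₊ + ⌊(j : ℝ) * x⌋₊ ≤ ⌊((i + j : ℕ) : ℝ) * x⌋₊ := by
      refine Nat.le_floor ?_
      have h1 := Nat.floor_le (a := (i : ℝ) * x) (by positivity)
      have h2 := Nat.floor_le (a := (j : ℝ) * x) (by positivity)
      push_cast
      linarith
    have hf' : ⌊((i + j : ℕ) : ℝ) * x⌋₊ < ⌊(i : ℝ) * x⌋₊ + ⌊(j : ℝ) * x⌋₊ + 2 := by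
      rw [Nat.floor_lt (by positivity)]
      have h1 := Nat.lt_floor_add_one ((i : ℝ) * x)
      have h2 := Nat.lt_floor_add_one ((j : ℝ) * x)
      push_cast
      linarith
    set a := ⌊(i : ℝ) * x⌋₊
    set b := ⌊(j : ℝ) * x⌋₊
    set c := ⌊((i + j : ℕ) : ℝ) * x⌋₊
    have hd1 : a / I * I ≤ a := Nat.div_mul_le_self a I
    have hd2 : a < a / I * I + I := Nat.lt_div_mul_add (by omega)
    obtain ⟨t, ht⟩ := Nat.exists_eq_add_of_le (show a / I * I ≤ c by omega)
    replace hf' := Nat.le_of_lt_succ hf'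
    rw [ht] at hf hf'
    refine ⟨a / I, t, ht.symm, ?_, ?_⟩ <;> generalize a / I = r at * <;> clear ht
    · rw [abs_le]
      rify at hd1 hd2
      push_cast
      constructor <;> linarith
    · rw [abs_le]
      rify at hd1 hd2 hf hf'
      constructor <;> linarith
  have hsubu : Subadditive u := by
    intro i j
    obtain ⟨r, t, h1, h2, h3⟩ := key hI hx i j
    obtain ⟨r', t', h1', h2', h3'⟩ := key hJ hy i j
    have e0 := hsub r r' t t'
    have e1 := abs_le.1 (hm (r * I) (r' * J) ⌊(i : ℝ) * x⌋₊ ⌊(i : ℝ) * y⌋₊)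
    have e2 := abs_le.1 (hm t t' ⌊(j : ℝ) * x⌋₊ ⌊(j : ℝ) * y⌋₊)
    simp only [hu]
    rw [← h1, ← h1']
    linarith [e1.2, e2.2]
  have hbdd : BddBelow (Set.range fun n => u n / n) := by
    refine ⟨0, ?_⟩
    rintro _ ⟨n, rfl⟩
    have := hm0 ⌊(n : ℝ) * x⌋₊ ⌊(n : ℝ) * y⌋₊
    have : 0 ≤ u n := by simp only [hu]; linarith
    positivity
  refine ⟨hsubu.lim, ?_⟩
  have := (hsubu.tendsto_lim hbdd).sub (tendsto_const_div_atTop_nhds_zero_nat C)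
  rw [sub_zero] at this
  refine this.congr fun n => ?_
  simp only [hu]
  ring

end S6V

/-! ### The limit shape: existence, Lipschitz bound and almost sure convergence. -/

theorem theorem1p1 (I J : ℕ) (hI : 1 ≤ I) (hJ : 1 ≤ J) (b₁ b₂ : ℕ → ℕ → ℝ)
    (hb₁ : ∀ x y : ℕ, 1 ≤ x → 1 ≤ y → b₁ x y ∈ Set.Icc (0 : ℝ) 1)
    (hb₂ : ∀ x y : ℕ, 1 ≤ x → 1 ≤ y → b₂ x y ∈ Set.Icc (0 : ℝ) 1)
    (hper₁ : ∀ x y : ℕ, 1 ≤ x → 1 ≤ y → b₁ (x + I) y = b₁ x y ∧ b₁ x (y + J) = b₁ x y)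
    (hper₂ : ∀ x y : ℕ, 1 ≤ x → 1 ≤ y → b₂ (x + I) y = b₂ x y ∧ b₂ x (y + J) = b₂ x y) :
    ∃ g : ℝ × ℝ → ℝ,
      (∃ K : NNReal, LipschitzOnWith K g (Set.Ici 0 ×ˢ Set.Ici 0)) ∧
      ∀ (Ω : Type*) [MeasurableSpace Ω] (μ : Measure Ω) [IsProbabilityMeasure μ]
        (σ : ℕ → ℕ → Ω → S6VConfig), S6V.IsModel b₁ b₂ μ σ →
        ∀ᵐ ω ∂μ, ∀ x y : ℝ, 0 ≤ x → 0 ≤ y →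
          Tendsto
            (fun n : ℕ =>
              (S6V.height (fun i j => σ i j ω) ⌊(n : ℝ) * x⌋₊ ⌊(n : ℝ) * y⌋₊ : ℝ) / (n : ℝ))
            atTop (𝓝 (g (x, y))) := by
  let p : ℕ × ℕ → unitInterval := fun v =>
    ⟨b₁ (v.1 + 1) (v.2 + 1), hb₁ _ _ (by omega) (by omega)⟩
  let q : ℕ × ℕ → unitInterval := fun v =>
    ⟨b₂ (v.1 + 1) (v.2 + 1), hb₂ _ _ (by omega) (by omega)⟩
  have hp : ∀ x y, (p (x, y) : ℝ) = b₁ (x + 1) (y + 1) := fun _ _ => rfl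
  have hq : ∀ x y, (q (x, y) : ℝ) = b₂ (x + 1) (y + 1) := fun _ _ => rfl
  have shift : ∀ b : ℕ → ℕ → ℝ,
      (∀ x y : ℕ, 1 ≤ x → 1 ≤ y → b (x + I) y = b x y ∧ b x (y + J) = b x y) →
      ∀ r s x y : ℕ, b (r * I + x + 1) (s * J + y + 1) = b (x + 1) (y + 1) := by
    intro b hb r s x y
    have h1 : ∀ y, b (r * I + x + 1) (y + 1) = b (x + 1) (y + 1) := by
      intro y
      induction r with
      | zero => simp
      | succ r ih =>
        rw [← ih, ← (hb (r * I + x + 1) (y + 1) (by omega) (by omega)).1]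
        congr 1
        ring
    rw [h1]
    induction s with
    | zero => simp
    | succ s ih =>
      rw [← ih, ← (hb (x + 1) (s * J + y + 1) (by omega) (by omega)).2]
      congr 1
      ring
  have hpper : ∀ r s : ℕ, ∀ v : ℕ × ℕ, p (r * I + v.1, s * J + v.2) = p v :=
    fun r s v => Subtype.ext (shift b₁ hper₁ r s v.1 v.2)
  have hqper : ∀ r s : ℕ, ∀ v : ℕ × ℕ, q (r * I + v.1, s * J + v.2) = q v :=
    fun r s v => Subtype.ext (shift b₂ hper₂ r s v.1 v.2)
  have hmean := S6V.abs_sub_le_of_succ (S6V.meanHeight_succ_left (p := p) (q := q))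
    (S6V.meanHeight_succ_right (p := p) (q := q))
  have hlim : ∀ z : ℝ × ℝ, ∃ l : ℝ, 0 ≤ z.1 → 0 ≤ z.2 → Tendsto (fun n : ℕ =>
      S6V.meanHeight p q ⌊(n : ℝ) * z.1⌋₊ ⌊(n : ℝ) * z.2⌋₊ / n) atTop (𝓝 l) := by
    intro z
    by_cases hz : 0 ≤ z.1 ∧ 0 ≤ z.2
    · obtain ⟨l, hl⟩ := S6V.exists_tendsto_floor_of_subadditive (S6V.meanHeight_nonneg p q) hmean
        hI hJ (fun r s => S6V.meanHeight_add_le (hpper r s) (hqper r s)) hz.1 hz.2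
      exact ⟨l, fun _ _ => hl⟩
    · exact ⟨0, fun h1 h2 => absurd ⟨h1, h2⟩ hz⟩
  choose g hg using hlim
  -- The mean is 1-Lipschitz for the ℓ¹ distance, which is at most twice the sup distance of `ℝ ×
  -- ℝ`.
  refine ⟨g, ⟨2, LipschitzOnWith.of_dist_le_mul ?_⟩, ?_⟩
  · rintro ⟨x, y⟩ ⟨hx, hy⟩ ⟨x', y'⟩ ⟨hx', hy'⟩
    simp only [Set.mem_Ici] at hx hy hx' hy'
    have hfl : ∀ {x x' : ℝ}, 0 ≤ x → 0 ≤ x' → ∀ n : ℕ,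
        |(⌊(n : ℝ) * x⌋₊ : ℝ) - ⌊(n : ℝ) * x'⌋₊| ≤ n * |x - x'| + 1 := by
      intro x x' hx hx' n
      have h1 := Nat.floor_le (a := (n : ℝ) * x) (by positivity)
      have h2 := Nat.lt_floor_add_one ((n : ℝ) * x)
      have h3 := Nat.floor_le (a := (n : ℝ) * x') (by positivity)
      have h4 := Nat.lt_floor_add_one ((n : ℝ) * x')
      have h5 := mul_le_mul_of_nonneg_left (neg_abs_le (x - x')) (Nat.cast_nonneg (α := ℝ) n)
      have h6 := mul_le_mul_of_nonneg_left (le_abs_self (x - x')) (Nat.cast_nonneg (α := ℝ) n)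
      rw [abs_le]
      constructor <;> nlinarith
    have ht := ((hg (x, y) hx hy).sub (hg (x', y') hx' hy')).abs
    have ht2 : Tendsto (fun n : ℕ => |x - x'| + |y - y'| + 2 / (n : ℝ)) atTop
        (𝓝 (|x - x'| + |y - y'| + 0)) :=
      tendsto_const_nhds.add (tendsto_const_div_atTop_nhds_zero_nat 2)
    have hle := le_of_tendsto_of_tendsto ht ht2 (by
      filter_upwards [eventually_gt_atTop 0] with n hn
      have hn' : (0 : ℝ) < n := by exact_mod_cast hn
      rw [← sub_div, abs_div, abs_of_pos hn', div_le_iff₀ hn', add_mul, div_mul_cancel₀ _ hn'.ne']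
      have e1 := hfl hx hx' n
      have e2 := hfl hy hy' n
      have e3 := hmean ⌊(n : ℝ) * x⌋₊ ⌊(n : ℝ) * y⌋₊ ⌊(n : ℝ) * x'⌋₊ ⌊(n : ℝ) * y'⌋₊
      nlinarith)
    have h1 : |x - x'| ≤ dist (x, y) (x', y') := by
      rw [Prod.dist_eq, ← Real.dist_eq]; exact le_max_left _ _
    have h2 : |y - y'| ≤ dist (x, y) (x', y') := by
      rw [Prod.dist_eq, ← Real.dist_eq]; exact le_max_right _ _
    rw [Real.dist_eq, NNReal.coe_ofNat]
    linarith
  · intro Ω _ μ _ σ h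
    -- The pairs (r, s) are countable, so a single null set suffices; the remaining argument is
    -- deterministic and treats all real x, y.
    have hdyadic : ∀ᵐ ω ∂μ, ∀ r s : ℕ, Tendsto (fun k : ℕ =>
        ((S6V.height (fun i j => σ i j ω) (2 ^ k * (r * I)) (2 ^ k * (s * J)) : ℝ) -
          S6V.meanHeight p q (2 ^ k * (r * I)) (2 ^ k * (s * J))) / 2 ^ k) atTop (𝓝 0) := by
      rw [ae_all_iff]
      intro r
      rw [ae_all_iff]
      intro s
      refine h.ae_tendsto_dyadic hp hq (fun k v => ?_) (fun k v => ?_)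
      · rw [← mul_assoc, ← mul_assoc, hpper]
      · rw [← mul_assoc, ← mul_assoc, hqper]
    filter_upwards [hdyadic, h.ae_abs_height_sub_le hp hq] with ω hω hlip x y hx hy
    have hh := S6V.abs_sub_le_of_succ
      (D := fun x y => (S6V.height (fun i j => σ i j ω) x y : ℝ)) (fun x y => (hlip x y).1) (fun x y => (hlip x y).2)
    -- The constant 2 adds the Lipschitz constants 1 of the height and of its mean.
    have hD := S6V.tendsto_floor_of_tendsto_dyadic (C := 2)
      (D := fun x y => (S6V.height (fun i j => σ i j ω) x y : ℝ) - S6V.meanHeight p q x y)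
      (fun x y x' y' => by
        have e1 := abs_le.1 (hh x y x' y')
        have e2 := abs_le.1 (hmean x y x' y')
        rw [abs_le]
        constructor <;> linarith [e1.1, e1.2, e2.1, e2.2]) hI hJ hω hx hy
    have := hD.add (hg (x, y) hx hy)
    rw [zero_add] at this
    refine this.congr fun n => ?_
    dsimp only
    ring
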